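/- Let $P$ be a finite graded poset with minimum $\hat 0$, maximum $\hat 1$ and rank function $\operatorname{rk}$ ($\operatorname{rk}\hat 0=0$); write $s\lessdot t$ when $t$ covers $s$. An edge labeling $\lambda$ of $P$ assigns to each pair $s\lessdot t$ an element $\lambda(s,t)$ of a totally ordered set $\Lambda$. It is an EL-labeling if for all $s\le t$ there is exactly one maximal chain $s=u_0\lessdot u_1\lessdot\cdots\lessdot u_k=t$ of $[s,t]$ with $\lambda(u_0,u_1)\le\lambda(u_1,u_2)\le\cdots\le\lambda(u_{k-1},u_k)$, and the label sequence of this chain is lexicographically minimal among the label sequences of all maximal chains of $[s,t]$. For $s\in P$ let $\lambda_1<\cdots<\lambda_\ell$ be the distinct labels of the covering relations $s\lessdot t$. For $i\ge 1$ let $\omega_s(i)$ be the number of $t$ with $s\lessdot t$ and $\lambda(s,t)=\lambda_i$ (so $\omega_s(i)=0$ for $i>\ell$). For $s\lessdot t$ let $\operatorname{Ind}(s,t)$ be the index $i$ with $\lambda(s,t)=\lambda_i$, and let $\operatorname{des}_s(t)$ be the number of distinct labels of covering relations $t\lessdot u$ that are strictly smaller than $\lambda(s,t)$. The poset $P$ is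 called UMEL-shellable if it has an EL-labeling $\lambda$ such that: - (uniform width) $\omega_s(i)=\omega_{s'}(i)$ for all $s,s'$ of the same rank and all $i\ge1$; - (uniform descent) $\operatorname{des}_s(t)=\operatorname{des}_{s'}(t')$ whenever $s\lessdot t$, $s'\lessdot t'$, $\operatorname{rk}s=\operatorname{rk}s'$ and $\operatorname{Ind}(s,t)=\operatorname{Ind}(s',t')$; - (monotonicity) for each $k<\operatorname{rk}(\hat 1)$, the common value $\operatorname{des}_k(i)$ of $\operatorname{des}_s(t)$ over all $s\lessdot t$ with $\operatorname{rk}s=k$ and $\operatorname{Ind}(s,t)=i$ is a weakly increasing function of $i$. For $s<t$ let $\overline\chi_{s,t}(x)=\frac{1}{x-1}\sum_{s\le u\le t}\mu(s,u)\,x^{\operatorname{rk}t-\operatorname{rk}u}$ be the reduced characteristic polynomial of $[s,t]$, where $\mu$ is the Möbius function. Define polynomials $\underline{\mathrm H}_{s,t}(x)$ by $\underline{\mathrm H}_{s,s}(x)=1$ and $\underline{\mathrm H}_{s,t}(x)=\sum_{s<u\le t}\overline\chi_{s,u}(x)\,\underline{\mathrm H}_{u,t}(x)$ for $s<t$. The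 Chow polynomial of $P$ is $\underline{\mathrm H}_P(x)=\underline{\mathrm H}_{\hat0,\hat1}(x)$, and the augmented Chow polynomial of $P$ is $\mathrm H_P(x)=\sum_{s\in P}x^{\operatorname{rk}s}\,\underline{\mathrm H}_{s,\hat1}(x)$. **Theorem A.** Let $P$ be a UMEL-shellable poset. Then: (i) all complex roots of the Chow polynomial $\underline{\mathrm H}_P(x)$ are real and nonpositive; (ii) all complex roots of the augmented Chow polynomial $\mathrm H_P(x)$ are real and nonpositive. -/

import Mathlib

universe u v

namespace UMEL

open Finset Polynomial

/-! ### Edge labelings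

An edge labeling of `P` with labels in the totally ordered set `Λ` is encoded by a function
`lab : P → P → Λ`; only its values `lab s t` on covering pairs `s ⋖ t` are ever used. -/

section Labelings

variable {P : Type u} [PartialOrder P] {Λ : Type v}

/-- `C` lists, from bottom to top, the elements of a saturated chain
`s = u₀ ⋖ u₁ ⋖ ⋯ ⋖ u_k = t` (that is, a maximal chain of the interval `[s, t]`). -/
def IsSaturatedChain (s t : P) (C : List P) : Prop :=
  C.head? = some s ∧ C.getLast? = some t ∧ C.IsChain (· ⋖ ·)

/-- The list of labels `λ(u₀,u₁), λ(u₁,u₂), …` read along the list `u₀, u₁, u₂, …`. -/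
def labels (lab : P → P → Λ) : List P → List Λ
  | a :: b :: C => lab a b :: labels lab (b :: C)
  | _ => []

variable [LinearOrder Λ]

/-- Edge-lexicographical labelings: in every interval `[s, t]` there is exactly one maximal chain
with weakly increasing labels, and its label sequence is minimal, in the lexicographic order
(the order `≤` on `List Λ`), among those of all maximal chains of `[s, t]`. -/
def IsELLabeling (lab : P → P → Λ) : Prop :=
  ∀ s t : P, s ≤ t → ∃ C : List P,
    IsSaturatedChain s t C ∧ (labels lab C).IsChain (· ≤ ·) ∧
    (∀ C', IsSaturatedChain s t C' → (labels lab C').IsChain (· ≤ ·) → C' = C) ∧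
    (∀ C', IsSaturatedChain s t C' → labels lab C ≤ labels lab C')

variable [Fintype P]

open Classical in
/-- The set `{λ₁ < ⋯ < λ_ℓ}` of labels of the covering relations above `s`. -/
noncomputable def labelsAbove (lab : P → P → Λ) (s : P) : Finset Λ :=
  ({t | s ⋖ t} : Finset P).image (lab s)

/-- The index (starting at `1`) of the label of `s ⋖ t` in the increasing list
`λ₁ < ⋯ < λ_ℓ` of labels above `s`. -/
noncomputable def ind (lab : P → P → Λ) (s t : P) : ℕ :=
  #{a ∈ labelsAbove lab s | a ≤ lab s t}

open Classical in
/-- The width above `s` at index `i`: the number of covers of `s` whose label is `λ_i`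
(and `0` when there is no `λ_i`). -/
noncomputable def width (lab : P → P → Λ) (s : P) (i : ℕ) : ℕ :=
  #({t | s ⋖ t ∧ ind lab s t = i} : Finset P)

/-- For `s ⋖ t`, the number of labels above `t` that are strictly smaller than the label
of `s ⋖ t`. -/
noncomputable def des (lab : P → P → Λ) (s t : P) : ℕ :=
  #{a ∈ labelsAbove lab t | a < lab s t}

variable [GradeMinOrder ℕ P]

/-- Rank-uniform labeled posets: an EL-labeling with uniform widths and uniform descents. -/
structure IsRankUniformLabeling (lab : P → P → Λ) : Prop where
  isEL : IsELLabeling lab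
  uniform_width : ∀ s s' : P, grade ℕ s = grade ℕ s' →
    ∀ i, 1 ≤ i → width lab s i = width lab s' i
  uniform_des : ∀ s s' t t' : P, grade ℕ s = grade ℕ s' → s ⋖ t → s' ⋖ t' →
    ind lab s t = ind lab s' t' → des lab s t = des lab s' t'

/-- Monotonic rank-uniform labeled posets: the number of descents is a weakly increasing
function of the index of the label. By uniformity, the descent count attached to a rank and an
index can be computed at any element of that rank, so both values are read at the same `s`. -/
structure IsMonotonicLabeling (lab : P → P → Λ) : Prop extends IsRankUniformLabeling lab where
  monotone_des : ∀ s t t' : P, s ⋖ t → s ⋖ t' → ind lab s t ≤ ind lab s t' →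
    des lab s t ≤ des lab s t'

end Labelings

/-- UMEL-shellable posets: those that admit a monotonic rank-uniform EL-labeling with labels in
some totally ordered set. -/
def UMELShellable (P : Type u) [PartialOrder P] [Fintype P] [GradeMinOrder ℕ P] : Prop :=
  ∃ (Λ : Type v) (_ : LinearOrder Λ) (lab : P → P → Λ), IsMonotonicLabeling lab

/-! ### Chow polynomials -/

section Chow

variable {P : Type u} [PartialOrder P] [LocallyFiniteOrder P] [DecidableEq P]

section

variable [GradeMinOrder ℕ P]

/-- The characteristic polynomial `∑_{u ∈ [s,t]} μ(s,u) x^{rk t - rk u}` of the interval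
`[s, t]`. -/
noncomputable def charPoly (s t : P) : ℤ[X] :=
  ∑ u ∈ Icc s t, C (IncidenceAlgebra.mu ℤ s u) * X ^ (grade ℕ t - grade ℕ u)

/-- The reduced characteristic polynomial `χ_{st}(x) / (x - 1)` of the interval `[s, t]`, for
`s < t`; the division is exact. -/
noncomputable def reducedCharPoly (s t : P) : ℤ[X] :=
  charPoly s t /ₘ (X - C 1)

theorem X_sub_one_mul_reducedCharPoly {s t : P} (h : s < t) :
    (X - C 1) * reducedCharPoly s t = charPoly s t := by
  refine mul_divByMonic_eq_iff_isRoot.2 ?_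
  simp [charPoly, IsRoot, eval_finsetSum, IncidenceAlgebra.sum_Icc_mu_right, h.ne]

/-- The Chow polynomial of the interval `[s, t]`, defined recursively by
`H_{s,s} = 1` and `H_{s,t} = ∑_{s < u ≤ t} χ̄_{s,u} H_{u,t}` for `s < t`. -/
noncomputable def chowInterval (s t : P) : ℤ[X] :=
  if s = t then 1
  else ∑ u ∈ (Ioc s t).attach, reducedCharPoly s u.1 * chowInterval u.1 t
termination_by (Icc s t).card
decreasing_by
  have hu := mem_Ioc.1 u.2
  exact card_lt_card (Icc_ssubset_Icc_left (hu.1.le.trans hu.2) hu.1 le_rfl)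

theorem chowInterval_eq (s t : P) :
    chowInterval s t = if s = t then 1
      else ∑ u ∈ Ioc s t, reducedCharPoly s u * chowInterval u t := by
  rw [chowInterval]
  split_ifs
  · rfl
  · exact sum_attach (Ioc s t) fun u => reducedCharPoly s u * chowInterval u t

end

variable (P) [BoundedOrder P] [GradeMinOrder ℕ P]

/-- The Chow polynomial of a finite graded bounded poset. -/
noncomputable def chowPoly : ℤ[X] :=
  chowInterval (⊥ : P) ⊤

/-- The augmented Chow polynomial `∑_s x^{rk s} H_{[s, 1̂]}(x)` of a finite graded bounded
poset. -/
noncomputable def augChowPoly : ℤ[X] :=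
  ∑ s ∈ Icc (⊥ : P) ⊤, X ^ grade ℕ s * chowInterval s ⊤

end Chow

/-- All complex roots of the polynomial are real and nonpositive. -/
def OnlyRealNonposRoots (p : ℤ[X]) : Prop :=
  ∀ z : ℂ, aeval z p = 0 → z.im = 0 ∧ z.re ≤ 0

end UMEL

/-! Put y = z/(1+z)². If z is not a nonpositive real, then y lies off the ray (-∞, 0], and after a
possible conjugation 0 ≤ arg y < π. It must be shown that neither polynomial vanishes at such a z.

Möbius inversion gives H_{s,⊤} = 1 + ∑_{r>s} (x + ⋯ + x^{rk r - rk s - 1}) H_{r,⊤}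
(`chowInterval_top_eq`). Sorting the r > s by the first edge of the increasing chain from s to r
writes the Chow and augmented Chow polynomials of [s, ⊤] as sums over the edges s ⋖ t. The edge
terms satisfy a coupled recursion (`edgeChow_eq`, `edgeAug_eq`) in which labels enter only through
comparisons of λ(s,t) with λ(t,u). By uniformity the terms depend only on rank and index, and after
division by powers of 1+z the recursion becomes v'_i = ∑_{j > d(i)} c_j w_j, w'_i = v'_i + y ∑_{j ≤
d(i)} c_j v_j, with c ≥ 0 and d weakly increasing (`IsMonotonicLabeling.edge_eq_labelLadder`).

For y > 0 everything is nonnegative. For Im y > 0 the recursion preserves a geometric form of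
interlacing (`IsConeOrdered.step`): v and w turn counterclockwise with the index inside one cone of
opening arg y < π. In such a pointed cone a nonnegative combination vanishes only if all its terms
do, and the increasing chain from ⊥ to ⊤ supplies a nonzero term. -/

namespace UMEL

open Finset Polynomial

/-! ### A recursion for Chow polynomials without the Möbius function -/

section ChowRecursion

variable {P : Type u} [PartialOrder P] [LocallyFiniteOrder P] [DecidableEq P]
  [GradeMinOrder ℕ P]

theorem charPoly_self (s : P) : charPoly s s = 1 := by
  simp [charPoly]

theorem sum_Icc_charPoly_left {s u : P} (h : s ≤ u) :
    ∑ r ∈ Icc s u, charPoly r u = X ^ (grade ℕ u - grade ℕ s) := by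
  simp only [charPoly]
  rw [Finset.sum_comm' (t' := Icc s u) (s' := fun t => Icc s t)]
  · have : ∀ t ∈ Icc s u, ∑ r ∈ Icc s t,
        (C (IncidenceAlgebra.mu ℤ r t) * X ^ (grade ℕ u - grade ℕ t) : ℤ[X])
        = if s = t then X ^ (grade ℕ u - grade ℕ t) else 0 := by
      intro t _
      rw [← Finset.sum_mul, ← map_sum, IncidenceAlgebra.sum_Icc_mu_left]
      split_ifs <;> simp
    rw [Finset.sum_congr rfl this, Finset.sum_ite_eq]
    simp [h]
  · intro r t
    simp only [mem_Icc]
    constructor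
    · rintro ⟨⟨h1, h2⟩, h3, h4⟩
      exact ⟨⟨h1, h3⟩, h1.trans h3, h4⟩
    · rintro ⟨⟨h1, h2⟩, h3, h4⟩
      exact ⟨⟨h1, h2.trans h4⟩, h2, h4⟩

variable [BoundedOrder P]

/-- This is the defining recursion times x - 1; the extra term u = s, where the characteristic
polynomial is 1, turns x - 1 into x. At s = ⊤ it reads 1 = x - (x - 1). -/
theorem sum_charPoly_mul_chowInterval (s : P) :
    ∑ u ∈ Icc s ⊤, charPoly s u * chowInterval u ⊤
      = X * chowInterval s ⊤ - if s = ⊤ then X - 1 else 0 := by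
  rw [← Finset.Ioc_insert_left (le_top : s ≤ ⊤), Finset.sum_insert (by simp), charPoly_self,
    one_mul]
  by_cases hs : s = ⊤
  · subst hs
    rw [chowInterval_eq, if_pos rfl]
    simp
  · have h1 := chowInterval_eq s (⊤ : P)
    rw [if_neg hs] at h1
    have h2 : ∑ u ∈ Ioc s ⊤, charPoly s u * chowInterval u ⊤
        = (X - C 1) * chowInterval s ⊤ := by
      rw [h1, Finset.mul_sum]
      refine Finset.sum_congr rfl fun u hu => ?_
      rw [← X_sub_one_mul_reducedCharPoly (mem_Ioc.1 hu).1]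
      ring
    rw [h2, if_neg hs]
    simp only [map_one]
    ring

/-- Summing the previous identity over all lower ends r ≥ s makes the characteristic polynomials
collapse by `sum_Icc_charPoly_left`. -/
theorem sum_X_pow_mul_chowInterval (s : P) :
    ∑ u ∈ Icc s ⊤, X ^ (grade ℕ u - grade ℕ s) * chowInterval u ⊤
      = X * ∑ u ∈ Icc s ⊤, chowInterval u ⊤ - (X - 1) := by
  have h1 : ∑ r ∈ Icc s ⊤, ∑ u ∈ Icc r ⊤, charPoly r u * chowInterval u ⊤
      = ∑ u ∈ Icc s ⊤, X ^ (grade ℕ u - grade ℕ s) * chowInterval u ⊤ := by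
    rw [Finset.sum_comm' (t' := Icc s ⊤) (s' := fun u => Icc s u)]
    · refine Finset.sum_congr rfl fun u hu => ?_
      rw [← Finset.sum_mul, sum_Icc_charPoly_left (mem_Icc.1 hu).1]
    · intro r u
      simp only [mem_Icc, le_top, and_true]
      exact ⟨fun h => ⟨h, h.1.trans h.2⟩, fun h => h.1⟩
  rw [← h1, Finset.sum_congr rfl fun r _ => sum_charPoly_mul_chowInterval r,
    Finset.sum_sub_distrib, ← Finset.mul_sum, Finset.sum_ite_eq' ]
  simp

/-- Divide the previous identity by x - 1, using (xⁿ - x)/(x - 1) = x + ⋯ + xⁿ⁻¹ for n ≥ 1. -/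
theorem chowInterval_top_eq (s : P) :
    chowInterval s ⊤ = 1 + ∑ u ∈ Ioc s ⊤,
      (∑ j ∈ Ico 1 (grade ℕ u - grade ℕ s), X ^ j) * chowInterval u ⊤ := by
  have h := sum_X_pow_mul_chowInterval s
  rw [← Finset.Ioc_insert_left (le_top : s ≤ ⊤), Finset.sum_insert (by simp),
    Finset.sum_insert (by simp)] at h
  refine mul_left_cancel₀ (X_sub_C_ne_zero (1 : ℤ)) ?_
  have h2 : (X - C 1) * ∑ u ∈ Ioc s ⊤,
      (∑ j ∈ Ico 1 (grade ℕ u - grade ℕ s), (X : ℤ[X]) ^ j) * chowInterval u ⊤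
      = ∑ u ∈ Ioc s ⊤, X ^ (grade ℕ u - grade ℕ s) * chowInterval u ⊤
        - X * ∑ u ∈ Ioc s ⊤, chowInterval u ⊤ := by
    rw [Finset.mul_sum, Finset.mul_sum, ← Finset.sum_sub_distrib]
    refine Finset.sum_congr rfl fun u hu => ?_
    have hlt : grade ℕ s < grade ℕ u := grade_strictMono (mem_Ioc.1 hu).1
    have h3 := geom_sum_Ico_mul (X : ℤ[X]) (show 1 ≤ grade ℕ u - grade ℕ s by omega)
    rw [← mul_assoc, mul_comm (X - C 1)]
    simp only [map_one]
    rw [h3]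
    ring
  rw [mul_add, h2]
  simp only [map_one, Nat.sub_self, pow_zero, one_mul, mul_one] at h ⊢
  linear_combination -h

end ChowRecursion

/-! ### First edges of increasing chains -/

section FirstStep

variable {P : Type u} [PartialOrder P] {Λ : Type v} [LinearOrder Λ]

/-- There is a saturated chain from `s` to `r` with weakly increasing labels whose second
element is `t`. -/
inductive IsFirstStep (lab : P → P → Λ) : P → P → P → Prop
  | single {s t : P} : s ⋖ t → IsFirstStep lab s t t
  | cons {s t u r : P} : s ⋖ t → lab s t ≤ lab t u → IsFirstStep lab t u r → IsFirstStep lab s t r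

variable {lab : P → P → Λ}

theorem IsFirstStep.covBy {s t r : P} (h : IsFirstStep lab s t r) : s ⋖ t := by
  cases h <;> assumption

theorem IsFirstStep.le {s t r : P} (h : IsFirstStep lab s t r) : t ≤ r := by
  induction h with
  | single _ => exact le_rfl
  | cons _ _ h ih => exact h.covBy.le.trans ih

theorem IsFirstStep.exists_chain {s t r : P} (h : IsFirstStep lab s t r) :
    ∃ C : List P, IsSaturatedChain s r (s :: t :: C) ∧
      (labels lab (s :: t :: C)).IsChain (· ≤ ·) := by
  induction h with
  | single h => exact ⟨[], by simp [IsSaturatedChain, h], by simp [labels]⟩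
  | @cons s t u r h hl _ ih =>
    obtain ⟨C, ⟨-, h2, h3⟩, h4⟩ := ih
    refine ⟨u :: C, ⟨rfl, ?_, ?_⟩, ?_⟩
    · simpa using h2
    · exact List.isChain_cons_cons.2 ⟨h, h3⟩
    · simp only [labels] at h4 ⊢
      exact List.isChain_cons_cons.2 ⟨hl, h4⟩

theorem isFirstStep_of_chain : ∀ (C : List P) {s t r : P}, IsSaturatedChain s r (s :: t :: C) →
    (labels lab (s :: t :: C)).IsChain (· ≤ ·) → IsFirstStep lab s t r
  | [], s, t, r, h, _ => by
    obtain ⟨-, h2, h3⟩ := h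
    simp at h2 h3
    subst h2
    exact .single h3
  | u :: C, s, t, r, h, hl => by
    obtain ⟨-, h2, h3⟩ := h
    simp only [labels] at hl
    have h3' := List.isChain_cons_cons.1 h3
    have hl' := List.isChain_cons_cons.1 hl
    refine .cons h3'.1 hl'.1 (isFirstStep_of_chain C ⟨rfl, by simpa using h2, h3'.2⟩ ?_)
    simpa only [labels] using hl'.2

theorem IsELLabeling.existsUnique_isFirstStep (hl : IsELLabeling lab) {s r : P} (h : s < r) :
    ∃! t, IsFirstStep lab s t r := by
  obtain ⟨C, hC, hinc, huniq, -⟩ := hl s r h.le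
  match C, hC, hinc, huniq with
  | [], hC, _, _ => simp [IsSaturatedChain] at hC
  | [a], hC, _, _ =>
    simp [IsSaturatedChain] at hC
    exact absurd (hC.1.symm.trans hC.2) h.ne
  | a :: t :: C, hC, hinc, huniq =>
    have ha : a = s := by simpa using hC.1
    subst ha
    refine ⟨t, isFirstStep_of_chain C hC hinc, fun t' ht' => ?_⟩
    obtain ⟨C', h1, h2⟩ := ht'.exists_chain
    have := huniq _ h1 h2
    simp only [List.cons.injEq, true_and] at this
    exact this.1

theorem isFirstStep_iff {s t r : P} (h : s ⋖ t) : IsFirstStep lab s t r ↔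
    r = t ∨ ∃ u, (t ⋖ u ∧ lab s t ≤ lab t u) ∧ IsFirstStep lab t u r := by
  constructor
  · intro h'
    cases h' with
    | single _ => exact Or.inl rfl
    | cons _ hl h2 => exact Or.inr ⟨_, ⟨h2.covBy, hl⟩, h2⟩
  · rintro (rfl | ⟨u, ⟨-, hl⟩, h2⟩)
    · exact .single h
    · exact .cons h hl h2

variable [Fintype P] {R : Type*} [AddCommMonoid R]

open Classical in
theorem sum_lt_eq_sum_isFirstStep (hl : IsELLabeling lab) (s : P) (φ : P → R) :
    ∑ r with s < r, φ r = ∑ t with s ⋖ t, ∑ r with IsFirstStep lab s t r, φ r := by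
  rw [Finset.sum_comm' (t' := ({r | s < r} : Finset P))
    (s' := fun r => ({t | IsFirstStep lab s t r} : Finset P))]
  · refine Finset.sum_congr rfl fun r hr => ?_
    obtain ⟨t, ht, htu⟩ := hl.existsUnique_isFirstStep (mem_filter.1 hr).2
    rw [Finset.sum_const, Finset.card_eq_one.2 ⟨t, ?_⟩, one_smul]
    ext t'
    simp only [mem_filter, mem_univ, true_and, mem_singleton]
    exact ⟨htu t', fun h => h ▸ ht⟩
  · intro t r
    simp only [mem_filter, mem_univ, true_and]
    exact ⟨fun h => ⟨h.2, h.1.lt.trans_le h.2.le⟩, fun h => ⟨h.1.covBy, h.1⟩⟩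

open Classical in
-- For r ≠ t, what remains of the chain above t is the increasing chain from t to r, so its first
-- step u is unique and no r is counted twice.
theorem sum_isFirstStep (hl : IsELLabeling lab) {s t : P} (h : s ⋖ t) (φ : P → R) :
    ∑ r with IsFirstStep lab s t r, φ r
      = φ t + ∑ u with t ⋖ u ∧ lab s t ≤ lab t u, ∑ r with IsFirstStep lab t u r, φ r := by
  have e : ({r | IsFirstStep lab s t r} : Finset P)
      = insert t ({r | t < r ∧ IsFirstStep lab s t r} : Finset P) := by
    ext r
    simp only [mem_filter, mem_univ, true_and, mem_insert]
    constructor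
    · intro hr
      rcases hr.le.eq_or_lt with h1 | h1
      · exact Or.inl h1.symm
      · exact Or.inr ⟨h1, hr⟩
    · rintro (rfl | hr)
      · exact .single h
      · exact hr.2
  rw [e, Finset.sum_insert (by simp)]
  congr 1
  rw [Finset.sum_comm' (t' := ({r | t < r ∧ IsFirstStep lab s t r} : Finset P))
    (s' := fun r => ({u | (t ⋖ u ∧ lab s t ≤ lab t u) ∧ IsFirstStep lab t u r} : Finset P))]
  · refine Finset.sum_congr rfl fun r hr => ?_
    obtain ⟨hr1, hr2⟩ := (mem_filter.1 hr).2
    obtain ⟨u, hu, hu'⟩ := ((isFirstStep_iff h).1 hr2).resolve_left hr1.ne'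
    rw [Finset.sum_const, Finset.card_eq_one.2 ⟨u, ?_⟩, one_smul]
    ext u'
    simp only [mem_filter, mem_univ, true_and, mem_singleton]
    constructor
    · exact fun h' => (hl.existsUnique_isFirstStep hr1).unique h'.2 hu'
    · rintro rfl
      exact ⟨hu, hu'⟩
  · intro u r
    simp only [mem_filter, mem_univ, true_and]
    constructor
    · rintro ⟨h1, h2⟩
      exact ⟨⟨h1, h2⟩, h1.1.lt.trans_le h2.le, .cons h h1.2 h2⟩
    · rintro ⟨h1, -⟩
      exact h1

end FirstStep

/-! ### Plane geometry of the recursion -/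

section Cone

/-- The real cross product of two complex numbers viewed as plane vectors. -/
noncomputable def cross (a b : ℂ) : ℝ := a.re * b.im - a.im * b.re

theorem cross_add_left (a b c : ℂ) : cross (a + b) c = cross a c + cross b c := by
  simp [cross]; ring

theorem cross_add_right (a b c : ℂ) : cross a (b + c) = cross a b + cross a c := by
  simp [cross]; ring

theorem cross_self (a : ℂ) : cross a a = 0 := by
  simp [cross]; ring

theorem cross_swap (a b : ℂ) : cross a b = -cross b a := by
  simp [cross]; ring

theorem cross_mul_mul (y a b : ℂ) : cross (y * a) (y * b) = Complex.normSq y * cross a b := by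
  simp [cross, Complex.normSq_apply]; ring

theorem cross_sum_left (c : ℕ → ℝ) (u : ℕ → ℂ) (I : Finset ℕ) (b : ℂ) :
    cross (∑ i ∈ I, (c i : ℂ) * u i) b = ∑ i ∈ I, c i * cross (u i) b := by
  simp only [cross, Complex.re_sum, Complex.im_sum, Complex.re_ofReal_mul,
    Complex.im_ofReal_mul, Finset.sum_mul, ← Finset.sum_sub_distrib]
  exact Finset.sum_congr rfl fun i _ => by ring

theorem cross_sum_right (c : ℕ → ℝ) (u : ℕ → ℂ) (I : Finset ℕ) (b : ℂ) :
    cross b (∑ i ∈ I, (c i : ℂ) * u i) = ∑ i ∈ I, c i * cross b (u i) := by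
  rw [cross_swap, cross_sum_left, ← Finset.sum_neg_distrib]
  exact Finset.sum_congr rfl fun i _ => by rw [cross_swap b]; ring

/-- If `u` turns counterclockwise and the index set `I` precedes `J` apart from a common block,
then the weighted sum over `I` precedes the one over `J`. -/
theorem cross_sum_sum_nonneg {u : ℕ → ℂ} (hu : ∀ i j, i ≤ j → 0 ≤ cross (u i) (u j))
    {c : ℕ → ℝ} (hc : ∀ i, 0 ≤ c i) {I J : Finset ℕ}
    (h : ∀ i ∈ I, ∀ j ∈ J, i ≤ j ∨ (i ∈ J ∧ j ∈ I)) :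
    0 ≤ cross (∑ i ∈ I, (c i : ℂ) * u i) (∑ j ∈ J, (c j : ℂ) * u j) := by
  have key : ∀ A B : Finset ℕ, (∀ i ∈ A, ∀ j ∈ B, i ≤ j) →
      0 ≤ cross (∑ i ∈ A, (c i : ℂ) * u i) (∑ j ∈ B, (c j : ℂ) * u j) := by
    intro A B hAB
    rw [cross_sum_left]
    refine Finset.sum_nonneg fun i hi => mul_nonneg (hc i) ?_
    rw [cross_sum_right]
    exact Finset.sum_nonneg fun j hj => mul_nonneg (hc j) (hu i j (hAB i hi j hj))
  -- The common block I ∩ J has cross product zero with itself, so only I \ J against J and I ∩ J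
  -- against J \ I remain.
  have h1 := key (I \ J) J (by
    intro i hi j hj
    rw [mem_sdiff] at hi
    exact (h i hi.1 j hj).resolve_right fun h' => hi.2 h'.1)
  have h2 := key (I ∩ J) (J \ I) (by
    intro i hi j hj
    rw [mem_sdiff] at hj
    exact (h i (mem_inter.1 hi).1 j hj.1).resolve_right fun h' => hj.2 h'.2)
  have e1 : ∑ i ∈ I, (c i : ℂ) * u i
      = ∑ i ∈ I \ J, (c i : ℂ) * u i + ∑ i ∈ I ∩ J, (c i : ℂ) * u i := by
    rw [add_comm, Finset.sum_inter_add_sum_sdiff]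
  have e2 : ∑ i ∈ J, (c i : ℂ) * u i
      = ∑ i ∈ J \ I, (c i : ℂ) * u i + ∑ i ∈ I ∩ J, (c i : ℂ) * u i := by
    rw [add_comm, Finset.inter_comm, Finset.sum_inter_add_sum_sdiff]
  rw [e1, cross_add_left]
  refine add_nonneg h1 ?_
  rw [e2, cross_add_right, cross_self, add_zero]
  exact h2

theorem cross_sum_sum_nonneg_of_sub {v w : ℕ → ℂ} (hv : ∀ i j, i ≤ j → 0 ≤ cross (v i) (v j))
    (hvw : ∀ i j, 0 ≤ cross (v i) (w j - v j))
    {c : ℕ → ℝ} (hc : ∀ i, 0 ≤ c i) {I J : Finset ℕ}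
    (h : ∀ i ∈ I, ∀ j ∈ J, i ≤ j ∨ (i ∈ J ∧ j ∈ I)) :
    0 ≤ cross (∑ i ∈ I, (c i : ℂ) * v i) (∑ j ∈ J, (c j : ℂ) * w j) := by
  have e : ∑ j ∈ J, (c j : ℂ) * w j
      = ∑ j ∈ J, (c j : ℂ) * v j + ∑ j ∈ J, (c j : ℂ) * (w j - v j) := by
    rw [← Finset.sum_add_distrib]
    exact Finset.sum_congr rfl fun j _ => by ring
  rw [e, cross_add_right]
  refine add_nonneg (cross_sum_sum_nonneg hv hc h) ?_
  rw [cross_sum_left]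
  refine Finset.sum_nonneg fun i _ => mul_nonneg (hc i) ?_
  rw [cross_sum_right (u := fun j => w j - v j)]
  exact Finset.sum_nonneg fun j _ => mul_nonneg (hc j) (hvw i j)

/-- Membership in the closed cone spanned by `φ` and `y * φ`. -/
def InCone (y φ z : ℂ) : Prop := 0 ≤ cross φ z ∧ 0 ≤ cross z (y * φ)

theorem InCone.add {y φ a b : ℂ} (ha : InCone y φ a) (hb : InCone y φ b) :
    InCone y φ (a + b) := by
  constructor
  · rw [cross_add_right]; exact add_nonneg ha.1 hb.1
  · rw [cross_add_left]; exact add_nonneg ha.2 hb.2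

theorem InCone.sum {y φ : ℂ} {u : ℕ → ℂ} (hu : ∀ i, InCone y φ (u i)) {c : ℕ → ℝ}
    (hc : ∀ i, 0 ≤ c i) (I : Finset ℕ) : InCone y φ (∑ i ∈ I, (c i : ℂ) * u i) := by
  constructor
  · rw [cross_sum_right]
    exact Finset.sum_nonneg fun i _ => mul_nonneg (hc i) (hu i).1
  · rw [cross_sum_left]
    exact Finset.sum_nonneg fun i _ => mul_nonneg (hc i) (hu i).2

/-- Cramer's rule in the basis φ, yφ, whose determinant is `y.im * Complex.normSq φ > 0`. -/
theorem InCone.exists_coords {y φ z : ℂ} (hy : 0 < y.im) (hφ : φ ≠ 0) (hz : InCone y φ z) :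
    ∃ p q : ℝ, 0 ≤ p ∧ 0 ≤ q ∧ z = φ * (p + q * y) := by
  have hN : 0 < Complex.normSq φ := Complex.normSq_pos.2 hφ
  have hD : 0 < y.im * Complex.normSq φ := mul_pos hy hN
  obtain ⟨p, hp⟩ : ∃ p, p * (y.im * Complex.normSq φ) = cross z (y * φ) :=
    ⟨_, div_mul_cancel₀ _ hD.ne'⟩
  obtain ⟨q, hq⟩ : ∃ q, q * (y.im * Complex.normSq φ) = cross φ z :=
    ⟨_, div_mul_cancel₀ _ hD.ne'⟩
  refine ⟨p, q, nonneg_of_mul_nonneg_left (hp ▸ hz.2) hD, nonneg_of_mul_nonneg_left (hq ▸ hz.1) hD,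
    ?_⟩
  simp only [cross, Complex.normSq_apply, Complex.mul_re, Complex.mul_im] at hp hq hD
  apply Complex.ext
  · refine mul_left_cancel₀ hD.ne' ?_
    simp only [Complex.mul_re, Complex.mul_im, Complex.add_re, Complex.add_im, Complex.ofReal_re,
      Complex.ofReal_im]
    linear_combination (-φ.re) * hp - (φ.re * y.re - φ.im * y.im) * hq
  · refine mul_left_cancel₀ hD.ne' ?_
    simp only [Complex.mul_re, Complex.mul_im, Complex.add_re, Complex.add_im, Complex.ofReal_re,
      Complex.ofReal_im]
    linear_combination (-φ.im) * hp - (φ.im * y.re + φ.re * y.im) * hq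

/-- Turning the earlier of two elements of a cone of opening `arg y` by `arg y` moves it past the
later one. -/
theorem cross_mul_nonneg {y φ a b : ℂ} (hy : 0 < y.im) (hφ : φ ≠ 0) (ha : InCone y φ a)
    (hb : InCone y φ b) (h : 0 ≤ cross b a) : 0 ≤ cross a (y * b) := by
  obtain ⟨p, q, hp, hq, rfl⟩ := ha.exists_coords hy hφ
  obtain ⟨p', q', hp', hq', rfl⟩ := hb.exists_coords hy hφ
  have hN : 0 < Complex.normSq φ := Complex.normSq_pos.2 hφ
  have e1 : cross (φ * (p' + q' * y)) (φ * (p + q * y))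
      = Complex.normSq φ * y.im * (p' * q - q' * p) := by
    simp [cross, Complex.normSq_apply]; ring
  have e2 : cross (φ * (p + q * y)) (y * (φ * (p' + q' * y)))
      = Complex.normSq φ * y.im *
        (p * p' + q * q' * (y.re ^ 2 + y.im ^ 2) + 2 * (p * q') * y.re) := by
    simp [cross, Complex.normSq_apply]; ring
  rw [e1] at h
  have h' : 0 ≤ p' * q - q' * p := nonneg_of_mul_nonneg_right h (mul_pos hN hy)
  rw [e2]
  refine mul_nonneg (mul_pos hN hy).le ?_
  rcases hq.eq_or_lt with h0 | h0
  · subst h0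
    have : q' * p = 0 := le_antisymm (by linarith) (mul_nonneg hq' hp)
    have h3 : p * q' = 0 := by linarith
    rw [h3]
    simp only [zero_mul, mul_zero, add_zero]
    exact mul_nonneg hp hp'
  -- The term in Re y may be negative, but q times the bracket equals p(p'q - q'p) + q'|p + qy|².
  · refine nonneg_of_mul_nonneg_right (a := q) ?_ h0
    have h4 : 0 ≤ p * (p' * q - q' * p) := mul_nonneg hp h'
    have h5 : 0 ≤ q' * ((p + q * y.re) ^ 2 + (q * y.im) ^ 2) := by positivity
    nlinarith [h4, h5]

theorem InCone.eq_zero {y φ z : ℂ} (hy : 0 < y.im) (hφ : φ ≠ 0) (hz : InCone y φ z)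
    (h1 : cross φ z = 0) (h2 : cross z (y * φ) = 0) : z = 0 := by
  have hN : 0 < Complex.normSq φ := Complex.normSq_pos.2 hφ
  obtain ⟨p, q, hp, hq, rfl⟩ := hz.exists_coords hy hφ
  have e1 : cross φ (φ * (p + q * y)) = Complex.normSq φ * y.im * q := by
    simp [cross, Complex.normSq_apply]; ring
  have e2 : cross (φ * (p + q * y)) (y * φ) = Complex.normSq φ * y.im * p := by
    simp [cross, Complex.normSq_apply]; ring
  rw [e1] at h1
  rw [e2] at h2
  have hD := (mul_pos hN hy).ne'
  rw [(mul_eq_zero.1 h1).resolve_left hD, (mul_eq_zero.1 h2).resolve_left hD]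
  simp

/-- The cone is pointed because 0 < arg y < π. -/
theorem InCone.eq_zero_of_add {y φ a b : ℂ} (hy : 0 < y.im) (hφ : φ ≠ 0) (ha : InCone y φ a)
    (hb : InCone y φ b) (h : a + b = 0) : a = 0 := by
  have h1 : cross φ (a + b) = 0 := by rw [h]; simp [cross]
  have h2 : cross (a + b) (y * φ) = 0 := by rw [h]; simp [cross]
  rw [cross_add_right] at h1
  rw [cross_add_left] at h2
  exact ha.eq_zero hy hφ (by linarith [ha.1, hb.1]) (by linarith [ha.2, hb.2])

theorem InCone.sum_ne_zero {y φ : ℂ} (hy : 0 < y.im) (hφ : φ ≠ 0) {u : ℕ → ℂ}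
    (hu : ∀ i, InCone y φ (u i)) {c : ℕ → ℝ} (hc : ∀ i, 0 ≤ c i) {I : Finset ℕ} {i : ℕ}
    (hi : i ∈ I) (hci : 0 < c i) (hui : u i ≠ 0) : ∑ i ∈ I, (c i : ℂ) * u i ≠ 0 := by
  intro h
  rw [← Finset.add_sum_erase _ _ hi] at h
  have hs : InCone y φ ((c i : ℂ) * u i) := by
    simpa using InCone.sum hu hc {i}
  have := hs.eq_zero_of_add hy hφ (InCone.sum hu hc _) h
  rcases mul_eq_zero.1 this with h0 | h0
  · exact hci.ne' (by exact_mod_cast h0)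
  · exact hui h0

/-- Two counterclockwise sequences in a common cone of opening `arg y`, such that all increments
`w j - v j` lie counterclockwise of all `v i`, and `v i` vanishes wherever `w i` does. -/
def IsConeOrdered (y : ℂ) (v w : ℕ → ℂ) : Prop :=
  (∃ φ : ℂ, φ ≠ 0 ∧ ∀ i, InCone y φ (v i) ∧ InCone y φ (w i)) ∧
  (∀ i j, i ≤ j → 0 ≤ cross (v i) (v j)) ∧
  (∀ i j, i ≤ j → 0 ≤ cross (w i) (w j)) ∧
  (∀ i j, 0 ≤ cross (v i) (w j - v j)) ∧
  ∀ i, w i = 0 → v i = 0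

theorem IsConeOrdered.step {y : ℂ} (hy : 0 < y.im) {v w : ℕ → ℂ} (h : IsConeOrdered y v w)
    {c : ℕ → ℝ} (hc : ∀ i, 0 ≤ c i) {L : ℕ} (hne : ∑ j ∈ range L, (c j : ℂ) * w j ≠ 0)
    {d : ℕ → ℕ} (hd : Monotone d) :
    IsConeOrdered y (fun i => ∑ j ∈ range L with d i < j, (c j : ℂ) * w j)
      (fun i => ∑ j ∈ range L with d i < j, (c j : ℂ) * w j
        + y * ∑ j ∈ range L with j ≤ d i, (c j : ℂ) * v j) := by
  obtain ⟨⟨φ, hφ, hK⟩, hv, hw, hvw, -⟩ := h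
  have Kv := fun I => InCone.sum (fun i => (hK i).1) hc I
  have Kw := fun I => InCone.sum (fun i => (hK i).2) hc I
  have VV : ∀ b b' : ℕ, b ≤ b' → 0 ≤ cross (∑ j ∈ range L with b < j, (c j : ℂ) * w j)
      (∑ j ∈ range L with b' < j, (c j : ℂ) * w j) := by
    intro b b' hb
    refine cross_sum_sum_nonneg hw hc ?_
    simp only [mem_filter, mem_range]
    intro i hi j hj
    omega
  -- An initial sum of v precedes a tail of w even when their ranges overlap; turned by y, it comes
  -- after.
  have VyA : ∀ b a : ℕ, 0 ≤ cross (∑ j ∈ range L with b < j, (c j : ℂ) * w j)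
      (y * ∑ j ∈ range L with j ≤ a, (c j : ℂ) * v j) := by
    intro b a
    refine cross_mul_nonneg hy hφ (Kw _) (Kv _) (cross_sum_sum_nonneg_of_sub hv hvw hc ?_)
    simp only [mem_filter, mem_range]
    intro i hi j hj
    omega
  -- The new cone starts at the total ∑ c_j w_j. Tails of w come after the total, and initial sums
  -- of v come before it, hence after it once multiplied by y.
  have KV : ∀ b, InCone y (∑ j ∈ range L, (c j : ℂ) * w j)
      (∑ j ∈ range L with b < j, (c j : ℂ) * w j) := by
    intro b
    have h0 : 0 ≤ cross (∑ j ∈ range L, (c j : ℂ) * w j)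
        (∑ j ∈ range L with b < j, (c j : ℂ) * w j) := by
      refine cross_sum_sum_nonneg hw hc ?_
      simp only [mem_filter, mem_range]
      intro i hi j hj
      omega
    exact ⟨h0, cross_mul_nonneg hy hφ (Kw _) (Kw _) h0⟩
  have KA : ∀ a, InCone y (∑ j ∈ range L, (c j : ℂ) * w j)
      (y * ∑ j ∈ range L with j ≤ a, (c j : ℂ) * v j) := by
    intro a
    have h0 : 0 ≤ cross (∑ j ∈ range L with j ≤ a, (c j : ℂ) * v j)
        (∑ j ∈ range L, (c j : ℂ) * w j) := by
      refine cross_sum_sum_nonneg_of_sub hv hvw hc ?_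
      simp only [mem_filter, mem_range]
      intro i hi j hj
      omega
    refine ⟨cross_mul_nonneg hy hφ (Kw _) (Kv _) h0, ?_⟩
    rw [cross_mul_mul]
    exact mul_nonneg (Complex.normSq_nonneg _) h0
  refine ⟨⟨_, hne, fun i => ⟨KV _, (KV _).add (KA _)⟩⟩, fun i j hij => VV _ _ (hd hij), ?_, ?_,
    fun i hi => (KV _).eq_zero_of_add hy hne (KA _) hi⟩
  · intro i j hij
    have hdd := hd hij
    have eV : ∑ l ∈ range L with d i < l, (c l : ℂ) * w l
        = ∑ l ∈ range L with d j < l, (c l : ℂ) * w l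
          + ∑ l ∈ range L with d i < l ∧ l ≤ d j, (c l : ℂ) * w l := by
      rw [← Finset.sum_union]
      · refine Finset.sum_congr ?_ fun _ _ => rfl
        ext l
        simp only [mem_filter, mem_union, mem_range]
        omega
      · rw [Finset.disjoint_left]
        simp only [mem_filter, mem_range]
        omega
    have eA : ∑ l ∈ range L with l ≤ d j, (c l : ℂ) * v l
        = ∑ l ∈ range L with l ≤ d i, (c l : ℂ) * v l
          + ∑ l ∈ range L with d i < l ∧ l ≤ d j, (c l : ℂ) * v l := by
      rw [← Finset.sum_union]
      · refine Finset.sum_congr ?_ fun _ _ => rfl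
        ext l
        simp only [mem_filter, mem_union, mem_range]
        omega
      · rw [Finset.disjoint_left]
        simp only [mem_filter, mem_range]
        omega
    have t1 : 0 ≤ cross (∑ l ∈ range L with d j < l, (c l : ℂ) * w l)
        (y * ∑ l ∈ range L with d i < l ∧ l ≤ d j, (c l : ℂ) * v l) := by
      refine cross_mul_nonneg hy hφ (Kw _) (Kv _) (cross_sum_sum_nonneg_of_sub hv hvw hc ?_)
      simp only [mem_filter, mem_range]
      intro i hi j hj
      omega
    have t2 : 0 ≤ cross (y * ∑ l ∈ range L with l ≤ d i, (c l : ℂ) * v l)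
        (y * ∑ l ∈ range L with d i < l ∧ l ≤ d j, (c l : ℂ) * v l) := by
      rw [cross_mul_mul]
      refine mul_nonneg (Complex.normSq_nonneg _) (cross_sum_sum_nonneg hv hc ?_)
      simp only [mem_filter, mem_range]
      intro i hi j hj
      omega
    have t3 : 0 ≤ cross (∑ l ∈ range L with d i < l ∧ l ≤ d j, (c l : ℂ) * w l)
        (∑ l ∈ range L with d j < l, (c l : ℂ) * w l) := by
      refine cross_sum_sum_nonneg hw hc ?_
      simp only [mem_filter, mem_range]
      intro i hi j hj
      omega
    have t4 : 0 ≤ cross (∑ l ∈ range L with d i < l ∧ l ≤ d j, (c l : ℂ) * w l)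
        (y * ∑ l ∈ range L with l ≤ d i, (c l : ℂ) * v l) := by
      refine cross_mul_nonneg hy hφ (Kw _) (Kv _) (cross_sum_sum_nonneg_of_sub hv hvw hc ?_)
      simp only [mem_filter, mem_range]
      intro i hi j hj
      omega
    have t5 : 0 ≤ cross (∑ l ∈ range L with d i < l ∧ l ≤ d j, (c l : ℂ) * w l)
        (y * ∑ l ∈ range L with d i < l ∧ l ≤ d j, (c l : ℂ) * v l) := by
      refine cross_mul_nonneg hy hφ (Kw _) (Kv _) (cross_sum_sum_nonneg_of_sub hv hvw hc ?_)
      intro i hi j hj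
      exact Or.inr ⟨hi, hj⟩
    beta_reduce
    rw [eV, eA]
    generalize (∑ l ∈ range L with d j < l, (c l : ℂ) * w l) = V at *
    generalize (∑ l ∈ range L with d i < l ∧ l ≤ d j, (c l : ℂ) * w l) = B at *
    generalize (∑ l ∈ range L with l ≤ d i, (c l : ℂ) * v l) = A at *
    generalize (∑ l ∈ range L with d i < l ∧ l ≤ d j, (c l : ℂ) * v l) = E at *
    -- Passing from i to j trades the block B of w for y times the same block E of v. In the
    -- expansion V × yA cancels yA × V, and the five terms left are `t1` to `t5`.
    have e : cross (V + B + y * A) (V + y * (A + E)) = cross V (y * E) + cross (y * A) (y * E)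
        + cross B V + cross B (y * A) + cross B (y * E) := by
      simp only [cross, Complex.add_re, Complex.add_im, mul_add]
      ring
    rw [e]
    positivity
  · intro i j
    beta_reduce
    rw [add_sub_cancel_left]
    exact VyA _ _

/-- The recursion for the two refined generating functions attached to the edges of a rank-uniform
labeled poset, as functions of the index of the edge; `p` is the corank of the upper end of the
edge, `c` and `d` record widths and descents. -/
noncomputable def ladder (y : ℂ) (L : ℕ) (c : ℕ → ℕ → ℝ) (d : ℕ → ℕ → ℕ) :
    ℕ → (ℕ → ℂ) × (ℕ → ℂ)
  | 0 => (fun _ => 1, fun _ => 1)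
  | p + 1 =>
    (fun i => ∑ j ∈ range L with d (p + 1) i < j, (c p j : ℂ) * (ladder y L c d p).2 j,
      fun i => ∑ j ∈ range L with d (p + 1) i < j, (c p j : ℂ) * (ladder y L c d p).2 j
        + y * ∑ j ∈ range L with j ≤ d (p + 1) i, (c p j : ℂ) * (ladder y L c d p).1 j)

variable {y : ℂ} {L : ℕ} {c : ℕ → ℕ → ℝ} {d : ℕ → ℕ → ℕ}

/-- `A` marks indices from which a path of positive weights leads down to level 0. Along it the
entries stay nonzero, which keeps ∑ c_j w_j, the first ray of the next cone, nonzero. -/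
theorem isConeOrdered_ladder (hy : 0 < y.im) (hc : ∀ p i, 0 ≤ c p i) (hd : ∀ p, Monotone (d p))
    {A : ℕ → ℕ → Prop}
    (hA : ∀ p i, A (p + 1) i → ∃ j < L, d (p + 1) i < j ∧ 0 < c p j ∧ A p j) (p : ℕ)
    (hp : ∃ i, A p i) :
    IsConeOrdered y (ladder y L c d p).1 (ladder y L c d p).2 ∧
      ∀ i, A p i → (ladder y L c d p).1 i ≠ 0 := by
  induction p with
  | zero =>
    refine ⟨⟨⟨1, one_ne_zero, fun i => ?_⟩, ?_, ?_, ?_, ?_⟩, ?_⟩ <;>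
      simp [ladder, InCone, cross, hy.le]
  | succ p ih =>
    obtain ⟨i, hi⟩ := hp
    obtain ⟨j, hjL, -, hcj, hj⟩ := hA p i hi
    obtain ⟨ho, hne⟩ := ih ⟨j, hj⟩
    have ⟨⟨φ, hφ, hK⟩, _, _, _, h0⟩ := ho
    refine ⟨ho.step hy (hc p) (InCone.sum_ne_zero hy hφ (fun i => (hK i).2) (hc p)
      (mem_range.2 hjL) hcj fun h => hne j hj (h0 j h)) (hd (p + 1)), fun i hi => ?_⟩
    obtain ⟨j, hjL, hdj, hcj, hj⟩ := hA p i hi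
    exact InCone.sum_ne_zero hy hφ (fun i => (hK i).2) (hc p)
      (mem_filter.2 ⟨mem_range.2 hjL, hdj⟩) hcj fun h => hne j hj (h0 j h)

theorem ladder_pos {r : ℝ} (hr : 0 < r) (hc : ∀ p i, 0 ≤ c p i)
    {A : ℕ → ℕ → Prop}
    (hA : ∀ p i, A (p + 1) i → ∃ j < L, d (p + 1) i < j ∧ 0 < c p j ∧ A p j) (p : ℕ) :
    ∃ a b : ℕ → ℝ, (∀ i, (ladder r L c d p).1 i = a i) ∧ (∀ i, (ladder r L c d p).2 i = b i) ∧
      (∀ i, 0 ≤ a i) ∧ (∀ i, a i ≤ b i) ∧ ∀ i, A p i → 0 < a i := by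
  induction p with
  | zero => exact ⟨fun _ => 1, fun _ => 1, by simp [ladder]⟩
  | succ p ih =>
    obtain ⟨a, b, ha, hb, ha0, hab, hA'⟩ := ih
    refine ⟨fun i => ∑ j ∈ range L with d (p + 1) i < j, c p j * b j,
      fun i => ∑ j ∈ range L with d (p + 1) i < j, c p j * b j
        + r * ∑ j ∈ range L with j ≤ d (p + 1) i, c p j * a j, ?_, ?_, ?_, ?_, ?_⟩
    · intro i
      simp [ladder, hb]
    · intro i
      simp [ladder, ha, hb]
    · exact fun i => Finset.sum_nonneg fun j _ => mul_nonneg (hc p j) ((ha0 j).trans (hab j))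
    · exact fun i => le_add_of_nonneg_right <| mul_nonneg hr.le <|
        Finset.sum_nonneg fun j _ => mul_nonneg (hc p j) (ha0 j)
    · intro i hi
      obtain ⟨j, hjL, hdj, hcj, hj⟩ := hA p i hi
      exact Finset.sum_pos' (fun j _ => mul_nonneg (hc p j) ((ha0 j).trans (hab j)))
        ⟨j, mem_filter.2 ⟨mem_range.2 hjL, hdj⟩, mul_pos hcj ((hA' j hj).trans_le (hab j))⟩

theorem sum_ladder_ne_zero (hy : y ∈ Complex.slitPlane) (hy0 : 0 ≤ y.im) (hc : ∀ p i, 0 ≤ c p i)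
    (hd : ∀ p, Monotone (d p)) {A : ℕ → ℕ → Prop}
    (hA : ∀ p i, A (p + 1) i → ∃ j < L, d (p + 1) i < j ∧ 0 < c p j ∧ A p j) (p : ℕ)
    {i : ℕ} (hiL : i < L) (hci : 0 < c p i) (hi : A p i) :
    ∑ j ∈ range L, (c p j : ℂ) * (ladder y L c d p).1 j ≠ 0 ∧
      ∑ j ∈ range L, (c p j : ℂ) * (ladder y L c d p).2 j ≠ 0 := by
  rcases hy0.eq_or_lt with h0 | h0
  · obtain ⟨r, rfl⟩ : ∃ r : ℝ, y = r := ⟨y.re, Complex.ext rfl (by simp [← h0])⟩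
    have hr : 0 < r := by simpa using hy
    obtain ⟨a, b, ha, hb, ha0, hab, hA'⟩ := ladder_pos hr hc hA p
    have h1 : 0 < ∑ j ∈ range L, c p j * a j :=
      Finset.sum_pos' (fun j _ => mul_nonneg (hc p j) (ha0 j))
        ⟨i, mem_range.2 hiL, mul_pos hci (hA' i hi)⟩
    have h2 : 0 < ∑ j ∈ range L, c p j * b j :=
      h1.trans_le (Finset.sum_le_sum fun j _ => mul_le_mul_of_nonneg_left (hab j) (hc p j))
    simp only [ha, hb]
    exact ⟨by exact_mod_cast h1.ne', by exact_mod_cast h2.ne'⟩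
  · obtain ⟨⟨⟨φ, hφ, hK⟩, -, -, -, hz⟩, hne⟩ := isConeOrdered_ladder h0 hc hd hA p ⟨i, hi⟩
    exact ⟨InCone.sum_ne_zero h0 hφ (fun i => (hK i).1) (hc p) (mem_range.2 hiL) hci (hne i hi),
      InCone.sum_ne_zero h0 hφ (fun i => (hK i).2) (hc p) (mem_range.2 hiL) hci
        fun h => hne i hi (hz i h)⟩

end Cone

/-! ### Edge contributions and their recursion -/

section EdgePolynomials

variable {P : Type u} [PartialOrder P] [BoundedOrder P] [Fintype P] [DecidableEq P]
  [LocallyFiniteOrder P] [GradeMinOrder ℕ P] {Λ : Type v} [LinearOrder Λ] {lab : P → P → Λ}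

theorem grade_eq_of_covBy {s t : P} (h : s ⋖ t) : grade ℕ t = grade ℕ s + 1 :=
  (Order.covBy_iff_add_one_eq.1 (h.grade ℕ)).symm

/-- The value at `z` of the Chow polynomial of the interval `[s, ⊤]`. -/
noncomputable def evalChow (z : ℂ) (s : P) : ℂ := aeval z (chowInterval s (⊤ : P))

theorem evalChow_top (z : ℂ) : evalChow z (⊤ : P) = 1 := by
  rw [evalChow, chowInterval_eq, if_pos rfl, map_one]

open Classical in
theorem evalChow_eq (z : ℂ) (s : P) : evalChow z s = 1 + ∑ r with s < r,
    (∑ j ∈ Ico 1 (grade ℕ r - grade ℕ s), z ^ j) * evalChow z r := by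
  have e : ({r | s < r} : Finset P) = Ioc s ⊤ := by ext; simp
  rw [evalChow, chowInterval_top_eq, e]
  simp [evalChow]

open Classical in
/-- The contribution to the Chow polynomial of `[s, ⊤]` of the increasing chains that start with
the edge `s ⋖ t`, evaluated at `z`. -/
noncomputable def edgeChow (lab : P → P → Λ) (z : ℂ) (s t : P) : ℂ :=
  ∑ r with IsFirstStep lab s t r,
    ((∑ j ∈ Ico 1 (grade ℕ r - grade ℕ s), z ^ j) * evalChow z r + if r = ⊤ then 1 else 0)

open Classical in
/-- The sum of `z ^ (rk r - rk t) * H_{r, ⊤}(z)` over the ends `r` of the increasing chains that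
start with the edge `s ⋖ t`. -/
noncomputable def edgePow (lab : P → P → Λ) (z : ℂ) (s t : P) : ℂ :=
  ∑ r with IsFirstStep lab s t r, z ^ (grade ℕ r - grade ℕ t) * evalChow z r

/-- The contribution of the edge `s ⋖ t` to the augmented Chow polynomial of `[s, ⊤]`. -/
noncomputable def edgeAug (lab : P → P → Λ) (z : ℂ) (s t : P) : ℂ :=
  edgeChow lab z s t + z * edgePow lab z s t

open Classical in
-- The constant 1 of `evalChow_eq` is charged to r = ⊤, which lies over exactly one first edge.
theorem evalChow_eq_sum_edgeChow (hl : IsELLabeling lab) (z : ℂ) {s : P} (hs : s ≠ ⊤) :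
    evalChow z s = ∑ t with s ⋖ t, edgeChow lab z s t := by
  simp only [edgeChow]
  rw [← sum_lt_eq_sum_isFirstStep hl s, evalChow_eq, Finset.sum_add_distrib,
    Finset.sum_ite_eq', if_pos (by simpa using hs.lt_top), add_comm]

open Classical in
theorem sum_pow_mul_evalChow (hl : IsELLabeling lab) (z : ℂ) {s : P} (hs : s ≠ ⊤) :
    ∑ r ∈ Icc s ⊤, z ^ (grade ℕ r - grade ℕ s) * evalChow z r
      = ∑ t with s ⋖ t, edgeAug lab z s t := by
  have e : Ioc s ⊤ = ({r | s < r} : Finset P) := by ext; simp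
  rw [← Finset.Ioc_insert_left (le_top : s ≤ ⊤), Finset.sum_insert (by simp), e,
    sum_lt_eq_sum_isFirstStep hl s, evalChow_eq_sum_edgeChow hl z hs]
  simp only [edgeAug, Nat.sub_self, pow_zero, one_mul]
  rw [Finset.sum_add_distrib]
  congr 1
  refine Finset.sum_congr rfl fun t ht => ?_
  rw [edgePow, Finset.mul_sum]
  refine Finset.sum_congr rfl fun r hr => ?_
  have h1 := grade_eq_of_covBy (mem_filter.1 ht).2
  have h2 : grade ℕ t ≤ grade ℕ r := grade_mono (mem_filter.1 hr).2.le
  rw [show grade ℕ r - grade ℕ s = grade ℕ r - grade ℕ t + 1 by omega, pow_succ]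
  ring

open Classical in
theorem filter_isFirstStep_top {s : P} (h : s ⋖ ⊤) :
    ({r | IsFirstStep lab s ⊤ r} : Finset P) = {⊤} := by
  ext r
  simp only [mem_filter, mem_univ, true_and, mem_singleton]
  refine ⟨fun h' => top_le_iff.1 h'.le, ?_⟩
  rintro rfl
  exact .single h

theorem edgeChow_top (z : ℂ) {s : P} (h : s ⋖ ⊤) : edgeChow lab z s ⊤ = 1 := by
  classical
  have := grade_eq_of_covBy h
  rw [edgeChow, filter_isFirstStep_top h]
  simp [this]

theorem edgeAug_top (z : ℂ) {s : P} (h : s ⋖ ⊤) : edgeAug lab z s ⊤ = 1 + z := by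
  classical
  rw [edgeAug, edgeChow_top z h]
  rw [edgePow, filter_isFirstStep_top h]
  simp [evalChow_top]

open Classical in
-- The end r = t contributes nothing: its geometric sum is empty and t ≠ ⊤. For the others, lowering
-- the base point from t to s adds one power of z to the geometric sum, and these powers form z
-- times `edgePow`.
theorem edgeChow_eq (hl : IsELLabeling lab) (z : ℂ) {s t : P} (h : s ⋖ t) (ht : t ≠ ⊤) :
    edgeChow lab z s t = ∑ u with t ⋖ u ∧ lab s t ≤ lab t u, edgeAug lab z t u := by
  have h1 := grade_eq_of_covBy h
  rw [edgeChow, sum_isFirstStep hl h, if_neg ht,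
    show grade ℕ t - grade ℕ s = 1 by omega]
  simp only [Finset.Ico_self, Finset.sum_empty, zero_mul, add_zero, zero_add]
  refine Finset.sum_congr rfl fun u hu => ?_
  rw [edgeAug, edgeChow, edgePow, Finset.mul_sum, ← Finset.sum_add_distrib]
  refine Finset.sum_congr rfl fun r hr => ?_
  have h2 := grade_eq_of_covBy (mem_filter.1 hu).2.1
  have h3 : grade ℕ u ≤ grade ℕ r := grade_mono (mem_filter.1 hr).2.le
  obtain ⟨k, hk⟩ := Nat.exists_eq_add_of_le h3
  rw [show grade ℕ r - grade ℕ s = k + 1 + 1 by omega, show grade ℕ r - grade ℕ t = k + 1 by omega,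
    show grade ℕ r - grade ℕ u = k by omega, Finset.sum_Ico_succ_top (by omega)]
  ring

open Classical in
theorem edgePow_eq (hl : IsELLabeling lab) (z : ℂ) {s t : P} (h : s ⋖ t) :
    edgePow lab z s t
      = evalChow z t + z * ∑ u with t ⋖ u ∧ lab s t ≤ lab t u, edgePow lab z t u := by
  rw [edgePow, sum_isFirstStep hl h]
  simp only [Nat.sub_self, pow_zero, one_mul]
  congr 1
  rw [Finset.mul_sum]
  refine Finset.sum_congr rfl fun u hu => ?_
  rw [edgePow, Finset.mul_sum]
  refine Finset.sum_congr rfl fun r hr => ?_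
  have h2 := grade_eq_of_covBy (mem_filter.1 hu).2.1
  have h3 : grade ℕ u ≤ grade ℕ r := grade_mono (mem_filter.1 hr).2.le
  rw [show grade ℕ r - grade ℕ t = grade ℕ r - grade ℕ u + 1 by omega, pow_succ]
  ring

open Classical in
-- In z times `edgePow_eq`, expand H_{t,⊤} over all edges above t. The ascents combine with their
-- `edgePow` terms to `edgeChow lab z s t` by `edgeChow_eq`; the descents are left over.
theorem edgeAug_eq (hl : IsELLabeling lab) (z : ℂ) {s t : P} (h : s ⋖ t) (ht : t ≠ ⊤) :
    edgeAug lab z s t = (1 + z) * edgeChow lab z s t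
      + z * ∑ u with t ⋖ u ∧ lab t u < lab s t, edgeChow lab z t u := by
  have h1 : ∑ u with t ⋖ u, edgeChow lab z t u
      = ∑ u with t ⋖ u ∧ lab s t ≤ lab t u, edgeChow lab z t u
        + ∑ u with t ⋖ u ∧ lab t u < lab s t, edgeChow lab z t u := by
    rw [← Finset.sum_filter_add_sum_filter_not _ (fun u => lab s t ≤ lab t u), Finset.filter_filter,
      Finset.filter_filter]
    simp only [not_le]
  have h2 := edgeChow_eq hl z h ht
  simp only [edgeAug] at h2
  rw [Finset.sum_add_distrib, ← Finset.mul_sum] at h2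
  rw [edgeAug, edgePow_eq hl z h, evalChow_eq_sum_edgeChow hl z ht, h1]
  linear_combination (-z) * h2

end EdgePolynomials

/-! ### Reduction of labels to indices -/

section Uniform

variable {P : Type u} [PartialOrder P] [Fintype P] {Λ : Type v} [LinearOrder Λ] {lab : P → P → Λ}

theorem mem_labelsAbove {s t : P} (h : s ⋖ t) : lab s t ∈ labelsAbove lab s := by
  classical
  exact mem_image.2 ⟨t, by simpa using h, rfl⟩

theorem ind_pos {s t : P} (h : s ⋖ t) : 0 < ind lab s t :=
  card_pos.2 ⟨lab s t, mem_filter.2 ⟨mem_labelsAbove h, le_rfl⟩⟩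

theorem ind_lt_card_add_one (s t : P) : ind lab s t < Fintype.card P + 1 := by
  classical
  refine Nat.lt_succ_of_le ((card_filter_le _ _).trans (card_image_le.trans ?_))
  exact card_le_univ _

/-- This is where labels disappear: whether t ⋖ u continues s ⋖ t increasingly depends only on its
index and on one number attached to s ⋖ t. -/
theorem des_lt_ind_iff {s t u : P} (h : t ⋖ u) :
    des lab s t < ind lab t u ↔ lab s t ≤ lab t u := by
  constructor
  · contrapose!
    intro h'
    exact card_le_card fun a ha => mem_filter.2
      ⟨(mem_filter.1 ha).1, (mem_filter.1 ha).2.trans_lt h'⟩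
  · intro h'
    refine card_lt_card ⟨fun a ha => mem_filter.2
      ⟨(mem_filter.1 ha).1, (mem_filter.1 ha).2.le.trans h'⟩, fun hs => ?_⟩
    have := hs (mem_filter.2 ⟨mem_labelsAbove h, le_rfl⟩)
    exact (mem_filter.1 this).2.not_ge h'

theorem width_zero (s : P) : width lab s 0 = 0 := by
  classical
  refine card_eq_zero.2 (filter_eq_empty_iff.2 fun t _ h => ?_)
  exact (ind_pos h.1).ne' h.2

theorem width_ind_pos {s t : P} (h : s ⋖ t) : 0 < width lab s (ind lab s t) := by
  classical
  exact card_pos.2 ⟨t, by simpa using h⟩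

open Classical in
-- No index exceeds `Fintype.card P`, and values j that are not attained carry width 0.
theorem sum_covBy_ind (t : P) (q : ℕ → Prop) (F : ℕ → ℂ) :
    ∑ u with t ⋖ u ∧ q (ind lab t u), F (ind lab t u)
      = ∑ j ∈ range (Fintype.card P + 1) with q j, (width lab t j : ℂ) * F j := by
  rw [← Finset.sum_fiberwise_of_maps_to (t := (range (Fintype.card P + 1)).filter q)
    (g := fun u => ind lab t u)]
  · refine Finset.sum_congr rfl fun j hj => ?_
    rw [Finset.sum_congr rfl (g := fun _ => F j), Finset.sum_const, nsmul_eq_mul, filter_filter]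
    · congr 2
      rw [width]
      congr 1
      ext u
      simp only [mem_filter, mem_univ, true_and]
      constructor
      · exact fun h => ⟨h.1.1, h.2⟩
      · exact fun h => ⟨⟨h.1, h.2 ▸ (mem_filter.1 hj).2⟩, h.2⟩
    · intro u hu
      rw [(mem_filter.1 hu).2]
  · intro u hu
    exact mem_filter.2 ⟨mem_range.2 (ind_lt_card_add_one t u), (mem_filter.1 hu).2.2⟩

variable [GradeMinOrder ℕ P]

open Classical in
/-- An element of rank `k`, if there is one. -/
noncomputable def ofRank [Nonempty P] (k : ℕ) : P :=
  if h : ∃ s : P, grade ℕ s = k then h.choose else Classical.arbitrary P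

theorem grade_ofRank [Nonempty P] (s : P) : grade ℕ (ofRank (grade ℕ s) : P) = grade ℕ s := by
  have h : ∃ s' : P, grade ℕ s' = grade ℕ s := ⟨s, rfl⟩
  rw [ofRank, dif_pos h]
  exact h.choose_spec

open Classical in
/-- The largest descent count among the edges of index at most `i` at rank `k`. -/
noncomputable def desAt [Nonempty P] (lab : P → P → Λ) (k i : ℕ) : ℕ :=
  ({t | (ofRank k : P) ⋖ t ∧ ind lab (ofRank k) t ≤ i} : Finset P).sup (des lab (ofRank k))

theorem monotone_desAt [Nonempty P] (lab : P → P → Λ) (k : ℕ) : Monotone (desAt lab k) := by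
  intro i j hij
  refine Finset.sup_mono fun t ht => ?_
  simp only [mem_filter, mem_univ, true_and] at ht ⊢
  exact ⟨ht.1, ht.2.trans hij⟩

theorem IsRankUniformLabeling.width_ofRank [Nonempty P] (hl : IsRankUniformLabeling lab) (s : P)
    (i : ℕ) : width lab (ofRank (grade ℕ s) : P) i = width lab s i := by
  rcases i.eq_zero_or_pos with rfl | hi
  · rw [width_zero, width_zero]
  · exact hl.uniform_width _ _ (grade_ofRank s) i hi

/-- Uniform width provides an edge of the same index above the representative of the rank; by
monotonicity it attains the supremum, and by uniform descent it has the same descent count. -/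
theorem IsMonotonicLabeling.desAt_eq [Nonempty P] (hl : IsMonotonicLabeling lab) {s t : P}
    (h : s ⋖ t) : desAt lab (grade ℕ s) (ind lab s t) = des lab s t := by
  classical
  have h1 := width_ind_pos (lab := lab) h
  rw [← hl.toIsRankUniformLabeling.width_ofRank] at h1
  obtain ⟨t', ht'⟩ := card_pos.1 h1
  simp only [mem_filter, mem_univ, true_and] at ht'
  have h2 := hl.uniform_des _ _ _ _ (grade_ofRank s) ht'.1 h ht'.2
  refine le_antisymm (Finset.sup_le fun t'' ht'' => ?_) ?_
  · simp only [mem_filter, mem_univ, true_and] at ht''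
    rw [← h2]
    exact hl.monotone_des _ _ _ ht''.1 ht'.1 (ht''.2.trans ht'.2.ge)
  · rw [← h2]
    exact Finset.le_sup (f := des lab _) (by simpa using ⟨ht'.1, ht'.2.le⟩)

end Uniform

/-! ### Real-rootedness -/

section RealRooted

/-- For real r ≤ 0 the equation z = r(1+z)² forces z to be real, as its discriminant is 1 - 4r > 0,
and then z ≤ 0. -/
theorem mem_slitPlane_of_eq {z y : ℂ} (hz : ¬(z.im = 0 ∧ z.re ≤ 0))
    (h : z = (1 + z) ^ 2 * y) : y ∈ Complex.slitPlane := by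
  rw [Complex.mem_slitPlane_iff]
  by_contra! hy
  obtain ⟨hre, him⟩ := hy
  obtain ⟨r, rfl⟩ : ∃ r : ℝ, y = r := ⟨y.re, Complex.ext rfl (by simp [him])⟩
  have e1 := congrArg Complex.re h
  have e2 := congrArg Complex.im h
  simp [pow_two] at e1 e2 hre
  by_cases hb : z.im = 0
  · refine hz ⟨hb, ?_⟩
    rw [hb] at e1
    nlinarith [mul_self_nonneg (1 + z.re)]
  · have e3 : 1 = 2 * (1 + z.re) * r := by
      refine mul_left_cancel₀ hb ?_
      linear_combination e2
    have e4 : 1 - 4 * r + 4 * (r * z.im) ^ 2 = 0 := by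
      linear_combination 4 * r * e1 + (1 - 2 * (1 + z.re) * r) * e3
    nlinarith [sq_nonneg (r * z.im)]

variable {P : Type u} [PartialOrder P] [BoundedOrder P] [Fintype P] [DecidableEq P]
  [LocallyFiniteOrder P] [GradeMinOrder ℕ P] {Λ : Type v} [LinearOrder Λ] {lab : P → P → Λ}

theorem grade_eq_grade_top_iff {s : P} : grade ℕ s = grade ℕ (⊤ : P) ↔ s = ⊤ :=
  ⟨fun h => by
    by_contra hs
    exact (grade_strictMono (α := P) (𝕆 := ℕ) (Ne.lt_top hs)).ne h, fun h => h ▸ rfl⟩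

/-- The ladder recursion attached to a labeling. -/
noncomputable def labelLadder (lab : P → P → Λ) (y : ℂ) : ℕ → (ℕ → ℂ) × (ℕ → ℂ) :=
  ladder y (Fintype.card P + 1)
    (fun p i => (width lab (ofRank (grade ℕ (⊤ : P) - 1 - p) : P) i : ℝ))
    (fun p => desAt lab (grade ℕ (⊤ : P) - 1 - p))

open Classical in
theorem IsMonotonicLabeling.sum_covBy_eq (hl : IsMonotonicLabeling lab) {t : P} {p : ℕ}
    (ht : grade ℕ t + p + 1 = grade ℕ (⊤ : P)) (q : ℕ → Prop) (F : ℕ → ℂ) :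
    ∑ u with t ⋖ u ∧ q (ind lab t u), F (ind lab t u)
      = ∑ j ∈ range (Fintype.card P + 1) with q j,
        (((width lab (ofRank (grade ℕ (⊤ : P) - 1 - p) : P) j : ℝ)) : ℂ) * F j := by
  rw [sum_covBy_ind, show grade ℕ (⊤ : P) - 1 - p = grade ℕ t by omega]
  refine Finset.sum_congr rfl fun j _ => ?_
  rw [hl.toIsRankUniformLabeling.width_ofRank]
  simp

/-- The substitution makes the recursion homogeneous in 1+z: z(1+z)^p = (1+z)^(p+2) y, so the
descent term carries the same power as the ascent term. -/
theorem IsMonotonicLabeling.edge_eq_labelLadder (hl : IsMonotonicLabeling lab) {z y : ℂ}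
    (h : z = (1 + z) ^ 2 * y) (p : ℕ) : ∀ s t : P, s ⋖ t →
    grade ℕ s + p + 1 = grade ℕ (⊤ : P) →
    edgeChow lab z s t = (1 + z) ^ p * (labelLadder lab y p).1 (ind lab s t) ∧
      edgeAug lab z s t = (1 + z) ^ (p + 1) * (labelLadder lab y p).2 (ind lab s t) := by
  classical
  induction p with
  | zero =>
    intro s t hst hs
    have ht : t = ⊤ := grade_eq_grade_top_iff.1 (by rw [grade_eq_of_covBy hst]; omega)
    subst ht
    rw [edgeChow_top z hst, edgeAug_top z hst]
    simp [labelLadder, ladder]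
  | succ p ih =>
    intro s t hst hs
    have hg := grade_eq_of_covBy hst
    have ht : t ≠ ⊤ := fun h' => by
      have := grade_eq_grade_top_iff.2 h'
      omega
    have htp : grade ℕ t + p + 1 = grade ℕ (⊤ : P) := by omega
    have hd : desAt lab (grade ℕ (⊤ : P) - 1 - (p + 1)) (ind lab s t) = des lab s t := by
      rw [show grade ℕ (⊤ : P) - 1 - (p + 1) = grade ℕ s by omega, hl.desAt_eq hst]
    have f1 : ({u | t ⋖ u ∧ lab s t ≤ lab t u} : Finset P)
        = ({u | t ⋖ u ∧ des lab s t < ind lab t u} : Finset P) :=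
      filter_congr fun u _ => and_congr_right fun hu => (des_lt_ind_iff hu).symm
    have f2 : ({u | t ⋖ u ∧ lab t u < lab s t} : Finset P)
        = ({u | t ⋖ u ∧ ind lab t u ≤ des lab s t} : Finset P) :=
      filter_congr fun u _ => and_congr_right fun hu => by
        rw [← not_le, ← des_lt_ind_iff hu, not_lt]
    have s1 : ∑ u with t ⋖ u ∧ des lab s t < ind lab t u, (labelLadder lab y p).2 (ind lab t u)
        = (labelLadder lab y (p + 1)).1 (ind lab s t) := by
      simp only [labelLadder, ladder, hd]
      convert hl.sum_covBy_eq htp (fun j => des lab s t < j) (labelLadder lab y p).2 <;> rfl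
    have s2 : ∑ u with t ⋖ u ∧ ind lab t u ≤ des lab s t, (labelLadder lab y p).1 (ind lab t u)
        = ∑ j ∈ range (Fintype.card P + 1) with j ≤ des lab s t,
          (((width lab (ofRank (grade ℕ (⊤ : P) - 1 - p) : P) j : ℝ)) : ℂ)
            * (labelLadder lab y p).1 j := by
      convert hl.sum_covBy_eq htp (fun j => j ≤ des lab s t) (labelLadder lab y p).1
    have s3 : (labelLadder lab y (p + 1)).2 (ind lab s t)
        = (labelLadder lab y (p + 1)).1 (ind lab s t)
          + y * ∑ u with t ⋖ u ∧ ind lab t u ≤ des lab s t,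
            (labelLadder lab y p).1 (ind lab t u) := by
      rw [s2]
      simp only [labelLadder, ladder, hd]
    have hv : edgeChow lab z s t
        = (1 + z) ^ (p + 1) * (labelLadder lab y (p + 1)).1 (ind lab s t) := by
      rw [edgeChow_eq hl.isEL z hst ht, f1,
        Finset.sum_congr rfl fun u hu => (ih t u (mem_filter.1 hu).2.1 htp).2,
        ← Finset.mul_sum, s1]
    refine ⟨hv, ?_⟩
    rw [edgeAug_eq hl.isEL z hst ht, f2, hv,
      Finset.sum_congr rfl fun u hu => (ih t u (mem_filter.1 hu).2.1 htp).1,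
      ← Finset.mul_sum, s3]
    linear_combination (1 + z) ^ p * (∑ u with t ⋖ u ∧ ind lab t u ≤ des lab s t,
      (labelLadder lab y p).1 (ind lab t u)) * h

/-- The witness is the next edge of the increasing chain to ⊤. -/
theorem IsMonotonicLabeling.exists_edge_of_isFirstStep (hl : IsMonotonicLabeling lab) (p i : ℕ)
    (h : ∃ s t : P, grade ℕ s + (p + 1) + 1 = grade ℕ (⊤ : P) ∧ ind lab s t = i ∧
      IsFirstStep lab s t ⊤) :
    ∃ j < Fintype.card P + 1, desAt lab (grade ℕ (⊤ : P) - 1 - (p + 1)) i < j ∧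
      (0 : ℝ) < width lab (ofRank (grade ℕ (⊤ : P) - 1 - p) : P) j ∧
      ∃ s t : P, grade ℕ s + p + 1 = grade ℕ (⊤ : P) ∧ ind lab s t = j ∧
        IsFirstStep lab s t ⊤ := by
  obtain ⟨s, t, hs, rfl, hst⟩ := h
  have hg := grade_eq_of_covBy hst.covBy
  rcases (isFirstStep_iff hst.covBy).1 hst with h' | ⟨u, ⟨htu, hlab⟩, hu⟩
  · rw [← h'] at hg
    omega
  · refine ⟨ind lab t u, ind_lt_card_add_one t u, ?_, ?_, t, u, by omega, rfl, hu⟩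
    · rw [show grade ℕ (⊤ : P) - 1 - (p + 1) = grade ℕ s by omega, hl.desAt_eq hst.covBy]
      exact (des_lt_ind_iff htu).2 hlab
    · rw [show grade ℕ (⊤ : P) - 1 - p = grade ℕ t by omega,
        hl.toIsRankUniformLabeling.width_ofRank]
      exact_mod_cast width_ind_pos htu

theorem aeval_augChowPoly (z : ℂ) :
    aeval z (augChowPoly P) = ∑ s ∈ Icc (⊥ : P) ⊤, z ^ grade ℕ s * evalChow z s := by
  simp [augChowPoly, evalChow]

theorem IsMonotonicLabeling.aeval_ne_zero (hl : IsMonotonicLabeling lab) {z y : ℂ}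
    (h : z = (1 + z) ^ 2 * y) (hz : 1 + z ≠ 0) (hy : y ∈ Complex.slitPlane) (hy0 : 0 ≤ y.im) :
    aeval z (chowPoly P) ≠ 0 ∧ aeval z (augChowPoly P) ≠ 0 := by
  classical
  have hgb : grade ℕ (⊥ : P) = 0 := by simp
  rcases eq_or_ne (⊥ : P) ⊤ with hb | hb
  · have h1 : evalChow z (⊥ : P) = 1 := by rw [hb, evalChow_top]
    refine ⟨?_, ?_⟩
    · change evalChow z (⊥ : P) ≠ 0
      rw [h1]
      exact one_ne_zero
    · rw [aeval_augChowPoly, ← hb, Finset.Icc_self, Finset.sum_singleton, h1, hgb]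
      simp
  have hpos : 0 < grade ℕ (⊤ : P) := hgb ▸ grade_strictMono (Ne.bot_lt hb.symm)
  obtain ⟨p, hp⟩ : ∃ p, p + 1 = grade ℕ (⊤ : P) := ⟨grade ℕ (⊤ : P) - 1, by omega⟩
  have hbp : grade ℕ (⊥ : P) + p + 1 = grade ℕ (⊤ : P) := by omega
  obtain ⟨t, ht, -⟩ := hl.isEL.existsUnique_isFirstStep (Ne.bot_lt hb.symm : (⊥ : P) < ⊤)
  obtain ⟨n1, n2⟩ := sum_ladder_ne_zero (L := Fintype.card P + 1)
    (c := fun p i => (width lab (ofRank (grade ℕ (⊤ : P) - 1 - p) : P) i : ℝ))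
    (d := fun p => desAt lab (grade ℕ (⊤ : P) - 1 - p)) hy hy0
    (fun p i => Nat.cast_nonneg _) (fun p => monotone_desAt lab _)
    (A := fun p i => ∃ s t : P, grade ℕ s + p + 1 = grade ℕ (⊤ : P) ∧ ind lab s t = i ∧
      IsFirstStep lab s t ⊤)
    hl.exists_edge_of_isFirstStep p (ind_lt_card_add_one (⊥ : P) t)
    (by
      rw [show grade ℕ (⊤ : P) - 1 - p = grade ℕ (⊥ : P) by omega,
        hl.toIsRankUniformLabeling.width_ofRank]
      exact_mod_cast width_ind_pos ht.covBy)
    ⟨⊥, t, hbp, rfl, ht⟩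
  have s1 := hl.sum_covBy_eq hbp (fun _ => True) (labelLadder lab y p).1
  have s2 := hl.sum_covBy_eq hbp (fun _ => True) (labelLadder lab y p).2
  simp only [and_true, Finset.filter_true] at s1 s2
  constructor
  · change evalChow z (⊥ : P) ≠ 0
    rw [evalChow_eq_sum_edgeChow hl.isEL z hb,
      Finset.sum_congr rfl fun t ht => (hl.edge_eq_labelLadder h p ⊥ t (mem_filter.1 ht).2 hbp).1,
      ← Finset.mul_sum, s1]
    exact mul_ne_zero (pow_ne_zero _ hz) n1
  · have e := sum_pow_mul_evalChow hl.isEL z hb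
    simp only [hgb, Nat.sub_zero] at e
    rw [aeval_augChowPoly, e,
      Finset.sum_congr rfl fun t ht => (hl.edge_eq_labelLadder h p ⊥ t (mem_filter.1 ht).2 hbp).2,
      ← Finset.mul_sum, s2]
    exact mul_ne_zero (pow_ne_zero _ hz) n2

theorem aeval_conj_eq_zero {p : ℤ[X]} {z : ℂ} (h : aeval z p = 0) :
    aeval (starRingEnd ℂ z) p = 0 := by
  have := Polynomial.aeval_algHom_apply ((starRingEnd ℂ : ℂ →+* ℂ).toIntAlgHom) z p
  simpa [h] using this

theorem IsMonotonicLabeling.eq_zero_imp (hl : IsMonotonicLabeling lab) {z : ℂ}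
    (h : aeval z (chowPoly P) = 0 ∨ aeval z (augChowPoly P) = 0) : z.im = 0 ∧ z.re ≤ 0 := by
  by_contra hneg
  have hz : 1 + z ≠ 0 := fun h0 => by
    rw [show z = -1 by linear_combination h0] at hneg
    simp at hneg
  have hy : z = (1 + z) ^ 2 * (z / (1 + z) ^ 2) := by field_simp
  have hs := mem_slitPlane_of_eq hneg hy
  rcases le_total 0 (z / (1 + z) ^ 2).im with h0 | h0
  · obtain ⟨h1, h2⟩ := hl.aeval_ne_zero hy hz hs h0
    exact h.elim h1 h2
  -- If Im y ≤ 0, pass to the conjugate of z, which is a root as well because the coefficients are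
  -- integers.
  · have hy' := congrArg (starRingEnd ℂ) hy
    rw [map_mul, map_pow, map_add, map_one] at hy'
    have hz' : 1 + starRingEnd ℂ z ≠ 0 := fun h' => hz (by
      simpa using congrArg (starRingEnd ℂ) h')
    have hs' := mem_slitPlane_of_eq (z := starRingEnd ℂ z) (by simpa using hneg) hy'
    obtain ⟨h1, h2⟩ := hl.aeval_ne_zero hy' hz' hs' (by simpa only [Complex.conj_im, neg_nonneg])
    exact h.elim (fun h => h1 (aeval_conj_eq_zero h)) (fun h => h2 (aeval_conj_eq_zero h))

end RealRooted

end UMEL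

theorem theoremA {P : Type u} [PartialOrder P] [BoundedOrder P] [Fintype P]
    [DecidableEq P] [LocallyFiniteOrder P] [GradeMinOrder ℕ P]
    (hP : UMEL.UMELShellable.{u, v} P) :
    UMEL.OnlyRealNonposRoots (UMEL.chowPoly P) ∧
      UMEL.OnlyRealNonposRoots (UMEL.augChowPoly P) := by
  obtain ⟨Λ, _, lab, hl⟩ := hP
  exact ⟨fun z hz => hl.eq_zero_imp (Or.inl hz), fun z hz => hl.eq_zero_imp (Or.inr hz)⟩
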